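/- Let $r$ be a positive integer and $[n]=\{1,\dots,n\}$. An $r$-graph $H$ on $[n]$ is a set of $r$-element subsets (edges) of $[n]$; $|H|$ is its number of edges and $\Delta(H)$ its maximum degree, i.e. the largest number of edges that contain a common vertex. A *forest* is an $r$-graph without cycles, where a *cycle* consists of distinct vertices $v_1,\dots,v_k$ and distinct edges $e_1,\dots,e_k$, $k\ge 2$, with $v_{i-1},v_i\in e_i$ for all $i$ (subscripts mod $k$). Let $\rho(F)$ be the maximum number of edges of a forest contained in $F$, and for $F\neq\emptyset$ let $$\varphi(F)=\max\{\,1-\rho(F')/|F'| \;:\; \emptyset\ne F'\subseteq F\,\}.$$ Let $\mathcal K^r_n$ be the set of all $r$-element subsets of $[n]$, and let $\mathcal F_H$ be the family of those subsets of $\mathcal K^r_n$ that contain a copy of $H$, i.e. an image of $H$ under a permutation of $[n]$. For $p\in[0,1]$ put $\mu_p(\mathcal F)=\sum_{S\in\mathcal F}p^{|S|}(1-p)^{|\mathcal K^r_n\setminus S|}$, and let the threshold $p_c(\mathcal F_H)$ be the unique $p\in[0,1]$ with $\mu_p(\mathcal F_H)=1/2$. **Theorem 7.1.** For each $r$ and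 each real $c$ there is a $K$ such that the following holds for all $n$ and $d$: if $H$ is an $r$-graph on $[n]$ with $|H|\ge 2$, $\Delta(H)\le d$ and $\varphi(H)\le c/\log n$, then $p_c(\mathcal F_H)$ is well defined and $$p_c(\mathcal F_H) < K\,d\,n^{-(r-1)}\log|H| .$$ -/

import Mathlib

/-- The edges of the complete `r`-graph `K^r_n` on the vertex set `[n]`. -/
abbrev KEdge (r n : ℕ) : Type := {e : Finset (Fin n) // e.card = r}

/-- An `r`-graph on `[n]`, given by its set of edges. -/
abbrev RGraph (r n : ℕ) : Type := Finset (KEdge r n)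

namespace RGraph

variable {r n : ℕ}

/-- The number of edges of `H` that contain the vertex `v`. -/
def degree (H : RGraph r n) (v : Fin n) : ℕ := (H.filter (fun e => v ∈ e.1)).card

/-- `Δ(H)`. -/
def maxDegree (H : RGraph r n) : ℕ := Finset.univ.sup (fun v => H.degree v)

/-- A cycle: distinct vertices `v_1, …, v_k` and distinct edges `e_1, …, e_k` of `F` with
`v_{i-1}, v_i ∈ e_i` for all `i`, the subscripts being taken modulo `k`.  (Length `k = 1` is not a
cycle: every vertex-edge incidence would be one.) -/
def HasCycle (F : RGraph r n) : Prop :=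
  ∃ k : ℕ, 2 ≤ k ∧ ∃ (v : ZMod k → Fin n) (e : ZMod k → KEdge r n),
    Function.Injective v ∧ Function.Injective e ∧
      ∀ i : ZMod k, e i ∈ F ∧ v (i - 1) ∈ (e i).1 ∧ v i ∈ (e i).1

/-- A forest is an `r`-graph that contains no cycle. -/
def IsForest (F : RGraph r n) : Prop := ¬ F.HasCycle

open Classical in
/-- `ρ(F)`, the maximum size (number of edges) of a forest in `F`. -/
noncomputable def forestNumber (F : RGraph r n) : ℕ :=
  (F.powerset.filter (fun G => IsForest G)).sup Finset.card

/-- `φ(F) = max {1 - ρ(F') / |F'| : ∅ ≠ F' ⊆ F}`. -/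
noncomputable def forestDeficiency (F : RGraph r n) : ℝ :=
  sSup {x : ℝ | ∃ F' : RGraph r n, F' ⊆ F ∧ F'.Nonempty ∧
    x = 1 - (F'.forestNumber : ℝ) / (F'.card : ℝ)}

/-- The supremum that defines `φ(F)` is a maximum as soon as `F` has an edge. -/
theorem isGreatest_forestDeficiency {F : RGraph r n} (hF : F.Nonempty) :
    IsGreatest {x : ℝ | ∃ F' : RGraph r n, F' ⊆ F ∧ F'.Nonempty ∧
      x = 1 - (F'.forestNumber : ℝ) / (F'.card : ℝ)} F.forestDeficiency := by
  set s := {x : ℝ | ∃ F' : RGraph r n, F' ⊆ F ∧ F'.Nonempty ∧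
      x = 1 - (F'.forestNumber : ℝ) / (F'.card : ℝ)} with hs
  have hfin : s.Finite := by
    refine ((Finset.finite_toSet F.powerset).image
      (fun F' : RGraph r n => 1 - (F'.forestNumber : ℝ) / (F'.card : ℝ))).subset ?_
    rintro x ⟨F', h1, _, rfl⟩
    exact ⟨F', by simpa using h1, rfl⟩
  have hne : s.Nonempty := ⟨_, F, subset_rfl, hF, rfl⟩
  exact ⟨hne.csSup_mem hfin, fun x hx => le_csSup hfin.bddAbove hx⟩

/-- The action on edges of a permutation of the vertices. -/
def permEdge (σ : Equiv.Perm (Fin n)) (e : KEdge r n) : KEdge r n :=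
  ⟨e.1.map σ.toEmbedding, by rw [Finset.card_map]; exact e.2⟩

/-- `G_H`: the (unlabeled) copies of `H` in `K^r_n`, that is, the images of `H` under the
permutations of `[n]`. -/
def copies (H : RGraph r n) : Set (Finset (KEdge r n)) :=
  {S | ∃ σ : Equiv.Perm (Fin n), S = Finset.image (permEdge σ) H}

end RGraph

/-- `⟨G⟩`: the sets that contain a member of `G`. -/
def upClosure {X : Type*} (G : Set (Finset X)) : Set (Finset X) :=
  {T | ∃ S ∈ G, S ⊆ T}

/-- `F_H`: the increasing family of all `r`-graphs on `[n]` that contain a copy of `H`. -/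
def containsCopy {r n : ℕ} (H : RGraph r n) : Set (Finset (KEdge r n)) :=
  upClosure H.copies

open Classical in
/-- `μ_p(F) = ∑_{S ∈ F} p^{|S|} (1-p)^{|X \ S|}`: the probability that the random subset of `X`
which contains each point independently with probability `p` belongs to `F`. -/
noncomputable def productProb {X : Type*} [Fintype X] (p : ℝ) (F : Set (Finset X)) : ℝ :=
  ∑ S ∈ Finset.univ.filter (fun S : Finset X => S ∈ F), p ^ S.card * (1 - p) ^ (Sᶜ).card

/-- `p` is the threshold `p_c(F)`: the unique `p ∈ [0,1]` with `μ_p(F) = 1/2`. -/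
def IsThreshold {X : Type*} [Fintype X] (F : Set (Finset X)) (p : ℝ) : Prop :=
  (p ∈ Set.Icc (0 : ℝ) 1 ∧ productProb p F = 1 / 2) ∧
    ∀ p' : ℝ, p' ∈ Set.Icc (0 : ℝ) 1 → productProb p' F = 1 / 2 → p' = p

/-! The image of `H` under a uniformly random permutation is spread: it contains a given edge set
`T` with probability at most `q ^ T.card`, where `q = C * Δ(H) / n ^ (r - 1)`. A spread distribution
on sets of size at most `l` has a member inside a random set of density `O(q log l)` with
probability above 1/2, so the threshold lies below that density.

Spread to threshold (`le_productProb_of_spread`): the random set is exposed in about `log₂ l` rounds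
of density `64 q`. After a round with outcome `W`, each member `A i` is replaced by a minimal
fragment `T = A j \ W ⊆ A i`. The pair `(W ∪ T, T)` determines `W`, and `T` lies in every member
contained in `W ∪ T`, so there are few candidates for it. Hence fragments larger than `l / 2` carry
little weight on average; the others are still spread, and `l` has halved.

Spreadness (`card_permHoms_div_le`): a forest is peeled edge by edge, a leaf edge costing a random
map a factor `Δ(H) * (r / n) ^ (r - 1)`; passing to permutations costs at most `e ^ r` per edge. Any
`S ⊆ H` contains a forest missing at most `c |S| / log n` of its edges, and the factors `n ^ (r -
1)` lost there multiply to at most `exp ((r - 1) c |S|)`. -/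

/-- The probability of the outcome `W` for the `p`-random subset of `X`. -/
noncomputable def bernoulliWeight {X : Type*} [Fintype X] (p : ℝ) (W : Finset X) : ℝ :=
  p ^ W.card * (1 - p) ^ (Fintype.card X - W.card)

/-! ### Random subsets and existence of thresholds -/

section BernoulliWeight

variable {X : Type*} [Fintype X]

theorem bernoulliWeight_nonneg {p : ℝ} (h0 : 0 ≤ p) (h1 : p ≤ 1) (W : Finset X) :
    0 ≤ bernoulliWeight p W :=
  mul_nonneg (pow_nonneg h0 _) (pow_nonneg (sub_nonneg.2 h1) _)

theorem sum_bernoulliWeight (p : ℝ) : ∑ W : Finset X, bernoulliWeight p W = 1 := by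
  have h := Finset.sum_pow_mul_eq_add_pow p (1 - p) (Finset.univ : Finset X)
  simpa [bernoulliWeight] using h

open Classical in
theorem productProb_eq_sum_filter (p : ℝ) (F : Set (Finset X)) :
    productProb p F = ∑ W : Finset X with W ∈ F, bernoulliWeight p W := by
  simp only [productProb, bernoulliWeight, Finset.card_compl]

open Classical in
theorem productProb_eq_sum_ite (p : ℝ) (F : Set (Finset X)) :
    productProb p F = ∑ W : Finset X, if W ∈ F then bernoulliWeight p W else 0 := by
  rw [productProb_eq_sum_filter, Finset.sum_filter]

theorem continuous_productProb (F : Set (Finset X)) : Continuous fun p => productProb p F := by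
  unfold productProb
  fun_prop

theorem productProb_mono {p : ℝ} (h0 : 0 ≤ p) (h1 : p ≤ 1) {F G : Set (Finset X)} (h : F ⊆ G) :
    productProb p F ≤ productProb p G := by
  classical
  rw [productProb_eq_sum_filter, productProb_eq_sum_filter]
  refine Finset.sum_le_sum_of_subset_of_nonneg ?_ fun W _ _ => bernoulliWeight_nonneg h0 h1 W
  intro W
  simpa using fun hW => h hW

theorem productProb_zero {F : Set (Finset X)} (h : ∅ ∉ F) : productProb 0 F = 0 := by
  classical
  rw [productProb_eq_sum_ite]
  refine Finset.sum_eq_zero fun W _ => ?_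
  split_ifs with hW
  · have : W.card ≠ 0 := by
      rw [Finset.card_ne_zero, Finset.nonempty_iff_ne_empty]
      rintro rfl
      exact h hW
    simp [bernoulliWeight, this]
  · rfl

theorem productProb_univ (p : ℝ) : productProb p (Set.univ : Set (Finset X)) = 1 := by
  classical
  rw [productProb_eq_sum_ite]
  simpa using sum_bernoulliWeight p

theorem productProb_one {F : Set (Finset X)} (h : Finset.univ ∈ F) : productProb 1 F = 1 := by
  classical
  rw [productProb_eq_sum_ite, Finset.sum_eq_single Finset.univ]
  · simp [h, bernoulliWeight]
  · intro W _ hW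
    have : Fintype.card X - W.card ≠ 0 := by
      have := (Finset.card_lt_iff_ne_univ W).2 hW
      omega
    simp [bernoulliWeight, this]
  · simp

/-- The union of independent `p`- and `s`-random sets is a `(p + (1 - p) s)`-random set. -/
theorem sum_bernoulliWeight_union [DecidableEq X] (p s : ℝ) (f : Finset X → ℝ) :
    ∑ U : Finset X, bernoulliWeight p U * ∑ V : Finset X, bernoulliWeight s V * f (U ∪ V) =
      ∑ W : Finset X, bernoulliWeight (p + (1 - p) * s) W * f W := by
  have key : ∀ W : Finset X,
      ∑ x : Finset X × Finset X with x.1 ∪ x.2 = W, bernoulliWeight p x.1 * bernoulliWeight s x.2 =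
        bernoulliWeight (p + (1 - p) * s) W := by
    intro W
    have h1 : ∑ x : Finset X × Finset X with x.1 ∪ x.2 = W,
          bernoulliWeight p x.1 * bernoulliWeight s x.2 =
        ∑ x ∈ W.powerset.sigma fun U => U.powerset,
          bernoulliWeight p x.1 * bernoulliWeight s ((W \ x.1) ∪ x.2) := by
      -- Given `U ∪ V = W`, the set `V` is determined by `U ∩ V`; what remains is two nested
      -- binomial sums.
      refine Finset.sum_bij' (fun x _ => ⟨x.1, x.1 ∩ x.2⟩) (fun y _ => (y.1, (W \ y.1) ∪ y.2))
        ?_ ?_ ?_ ?_ ?_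
      · rintro ⟨U, V⟩ h
        simp only [Finset.mem_filter, Finset.mem_univ, true_and] at h
        subst h
        exact Finset.mem_sigma.2 ⟨Finset.mem_powerset.2 Finset.subset_union_left,
          Finset.mem_powerset.2 Finset.inter_subset_left⟩
      · rintro ⟨U, B⟩ h
        simp only [Finset.mem_sigma, Finset.mem_powerset] at h
        simp only [Finset.mem_filter, Finset.mem_univ, true_and]
        ext x
        have := @h.1 x
        have := @h.2 x
        simp only [Finset.mem_union, Finset.mem_sdiff]
        tauto
      · rintro ⟨U, V⟩ h
        simp only [Finset.mem_filter, Finset.mem_univ, true_and] at h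
        subst h
        simp only [Prod.mk.injEq, true_and]
        ext x
        simp only [Finset.mem_union, Finset.mem_sdiff, Finset.mem_inter]
        tauto
      · rintro ⟨U, B⟩ h
        simp only [Finset.mem_sigma, Finset.mem_powerset] at h
        simp only [Sigma.mk.injEq, heq_eq_eq, true_and]
        ext x
        have := @h.2 x
        simp only [Finset.mem_union, Finset.mem_sdiff, Finset.mem_inter]
        tauto
      · rintro ⟨U, V⟩ h
        simp only [Finset.mem_filter, Finset.mem_univ, true_and] at h
        subst h
        congr 2
        ext x
        simp only [Finset.mem_union, Finset.mem_sdiff, Finset.mem_inter]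
        tauto
    rw [h1, Finset.sum_sigma]
    have h2 : ∀ U ∈ W.powerset, ∑ B ∈ U.powerset,
          bernoulliWeight p U * bernoulliWeight s ((W \ U) ∪ B) =
        ((1 - p) * (1 - s)) ^ (Fintype.card X - W.card) *
          (p ^ U.card * ((1 - p) * s) ^ (W.card - U.card)) := by
      intro U hU
      rw [Finset.mem_powerset] at hU
      have hUW := Finset.card_le_card hU
      have hWX := Finset.card_le_univ W
      have h3 : ∀ B ∈ U.powerset, bernoulliWeight p U * bernoulliWeight s ((W \ U) ∪ B) =
          ((1 - p) * (1 - s)) ^ (Fintype.card X - W.card) *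
          (p ^ U.card * ((1 - p) * s) ^ (W.card - U.card)) *
            (s ^ B.card * (1 - s) ^ (U.card - B.card)) := by
        intro B hB
        rw [Finset.mem_powerset] at hB
        have hBU := Finset.card_le_card hB
        have hd : Disjoint (W \ U) B := Finset.disjoint_of_subset_right hB Finset.sdiff_disjoint
        have hc : ((W \ U) ∪ B).card = (W.card - U.card) + B.card := by
          rw [Finset.card_union_of_disjoint hd, Finset.card_sdiff_of_subset hU]
        rw [bernoulliWeight, bernoulliWeight, hc,
          show Fintype.card X - U.card = (Fintype.card X - W.card) + (W.card - U.card) by omega,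
          show Fintype.card X - (W.card - U.card + B.card) =
            (Fintype.card X - W.card) + (U.card - B.card) by omega]
        simp only [pow_add, mul_pow]
        ring
      rw [Finset.sum_congr rfl h3, ← Finset.mul_sum, Finset.sum_pow_mul_eq_add_pow]
      simp
    rw [Finset.sum_congr rfl h2, ← Finset.mul_sum, Finset.sum_pow_mul_eq_add_pow, bernoulliWeight,
      mul_comm, show 1 - (p + (1 - p) * s) = (1 - p) * (1 - s) by ring]
  simp only [← key, Finset.sum_mul, Finset.mul_sum]
  rw [← Finset.sum_product', Finset.univ_product_univ,
    ← Finset.sum_fiberwise (s := Finset.univ) (g := fun x : Finset X × Finset X => x.1 ∪ x.2)]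
  refine Finset.sum_congr rfl fun W _ => Finset.sum_congr rfl fun x hx => ?_
  rw [← (Finset.mem_filter.1 hx).2]
  ring

theorem productProb_add [DecidableEq X] (p s : ℝ) (F : Set (Finset X)) :
    productProb (p + (1 - p) * s) F =
      ∑ U : Finset X, bernoulliWeight p U * productProb s {V | U ∪ V ∈ F} := by
  classical
  have h := sum_bernoulliWeight_union p s fun W : Finset X => if W ∈ F then (1 : ℝ) else 0
  simp only [mul_ite, mul_one, mul_zero] at h
  rw [productProb_eq_sum_ite]
  simp only [productProb_eq_sum_ite, Set.mem_ofPred_eq]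
  exact h.symm

/-- Coupling: a `p'`-random set is a `p`-random set joined with an independent `s`-random one. The
gain is strict because the first can be empty while the second is everything. -/
theorem productProb_strictMono {F : Set (Finset X)} (hF : ∀ S ∈ F, ∀ T, S ⊆ T → T ∈ F)
    (h0 : ∅ ∉ F) (h1 : Finset.univ ∈ F) {p p' : ℝ} (hp : 0 ≤ p) (hpp' : p < p') (hp' : p' ≤ 1) :
    productProb p F < productProb p' F := by
  classical
  have hp1 : 0 < 1 - p := by linarith
  obtain ⟨s, hs⟩ : ∃ s, s = (p' - p) / (1 - p) := ⟨_, rfl⟩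
  have hs0 : 0 < s := hs ▸ div_pos (by linarith) hp1
  have hs1 : s ≤ 1 := hs ▸ (div_le_one hp1).2 (by linarith)
  have hps : p' = p + (1 - p) * s := by rw [hs]; field_simp; ring
  have hrw : productProb p F = ∑ U : Finset X, bernoulliWeight p U * if U ∈ F then 1 else 0 := by
    simp [productProb_eq_sum_ite]
  rw [hps, productProb_add, hrw]
  have hnn : ∀ G : Set (Finset X), 0 ≤ productProb s G := fun G => by
    rw [productProb_eq_sum_filter]
    exact Finset.sum_nonneg fun W _ => bernoulliWeight_nonneg hs0.le hs1 W
  refine Finset.sum_lt_sum (fun U _ => ?_) ⟨∅, Finset.mem_univ _, ?_⟩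
  · refine mul_le_mul_of_nonneg_left ?_ (bernoulliWeight_nonneg hp (by linarith) U)
    split_ifs with hU
    · have : {V | U ∪ V ∈ F} = Set.univ :=
        Set.eq_univ_of_forall fun V => hF U hU _ Finset.subset_union_left
      rw [this, productProb_univ]
    · exact hnn _
  · simp only [h0, if_false, mul_zero, Finset.empty_union, Set.ofPred_mem_eq]
    refine mul_pos ?_ ?_
    · simpa [bernoulliWeight] using pow_pos hp1 _
    · rw [productProb_eq_sum_filter]
      refine Finset.sum_pos' (fun W _ => bernoulliWeight_nonneg hs0.le hs1 W)
        ⟨Finset.univ, by simpa using h1, ?_⟩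
      simpa [bernoulliWeight] using pow_pos hs0 _

/-- A nontrivial increasing family has a threshold. -/
theorem exists_isThreshold {F : Set (Finset X)} (hF : ∀ S ∈ F, ∀ T, S ⊆ T → T ∈ F)
    (h0 : ∅ ∉ F) (h1 : Finset.univ ∈ F) : ∃ p, IsThreshold F p := by
  have hiv := intermediate_value_Icc (zero_le_one (α := ℝ))
    (continuous_productProb F).continuousOn
  simp only [productProb_zero h0, productProb_one h1] at hiv
  obtain ⟨p, hp, hpe⟩ := hiv (show (1 / 2 : ℝ) ∈ Set.Icc 0 1 by norm_num)
  refine ⟨p, ⟨hp, hpe⟩, fun p' hp' hpe' => ?_⟩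
  rcases lt_trichotomy p p' with h | h | h
  · have := productProb_strictMono hF h0 h1 hp.1 h hp'.2
    simp only at hpe
    linarith
  · exact h.symm
  · have := productProb_strictMono hF h0 h1 hp'.1 h hp.2
    simp only at hpe
    linarith

end BernoulliWeight

/-! ### Spread families and minimal fragments -/

section Spread

variable {X ι : Type*} [Fintype X]

/-- Among the sets `A j \ W` contained in `A i` there is a minimal one. -/
theorem exists_minimal_fragment [DecidableEq X] (I : Finset ι) (A : ι → Finset X) (W : Finset X)
    {i : ι} (hi : i ∈ I) :
    ∃ T : Finset X, T ⊆ A i ∧ Disjoint W T ∧ (∃ j ∈ I, A j ⊆ W ∪ T) ∧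
      ∀ k ∈ I, A k ⊆ W ∪ T → T ⊆ A k := by
  obtain ⟨j, hj, hmin⟩ := (I.filter fun j => A j \ W ⊆ A i).exists_min_image
    (fun j => (A j \ W).card) ⟨i, by simp [hi]⟩
  rw [Finset.mem_filter] at hj
  refine ⟨A j \ W, hj.2, Finset.disjoint_sdiff, ⟨j, hj.1, by simp⟩, fun k hk hkW => ?_⟩
  have hsub : A k \ W ⊆ A j \ W := by
    intro x hx
    rw [Finset.mem_sdiff] at hx
    have := hkW hx.1
    rw [Finset.mem_union] at this
    tauto
  have := Finset.eq_of_subset_of_card_le hsub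
    (hmin k (Finset.mem_filter.2 ⟨hk, hsub.trans hj.2⟩))
  rw [← this]
  exact Finset.sdiff_subset

theorem bernoulliWeight_le_union [DecidableEq X] {p : ℝ} (h0 : 0 < p) (h1 : p ≤ 1)
    {W T : Finset X} (h : Disjoint W T) :
    bernoulliWeight p W ≤ bernoulliWeight p (W ∪ T) * (1 / p) ^ T.card := by
  rw [bernoulliWeight, bernoulliWeight, Finset.card_union_of_disjoint h]
  have : p ^ (W.card + T.card) * (1 - p) ^ (Fintype.card X - (W.card + T.card)) *
      (1 / p) ^ T.card = p ^ W.card * (1 - p) ^ (Fintype.card X - (W.card + T.card)) := by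
    rw [pow_add, div_pow, one_pow]
    field_simp
  rw [this]
  exact mul_le_mul_of_nonneg_left
    (pow_le_pow_of_le_one (by linarith) (by linarith) (by omega)) (pow_nonneg h0.le _)

open Classical in
/-- In a spread family it is unlikely that a minimal fragment is large. -/
theorem sum_large_fragment_le {I : Finset ι} {A : ι → Finset X} {w : ι → ℝ} {q : ℝ} {l : ℕ}
    (hw : ∀ i, 0 ≤ w i) (hq : 0 < q) (hq1 : 64 * q ≤ 1) (hl : ∀ i ∈ I, (A i).card ≤ l)
    (hspread : ∀ T : Finset X, ∑ i ∈ I with T ⊆ A i, w i ≤ q ^ T.card)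
    {T : Finset X → ι → Finset X}
    (hT : ∀ W, ∀ i ∈ I, T W i ⊆ A i ∧ Disjoint W (T W i) ∧ (∃ j ∈ I, A j ⊆ W ∪ T W i) ∧
      ∀ k ∈ I, A k ⊆ W ∪ T W i → T W i ⊆ A k) :
    ∑ W : Finset X, bernoulliWeight (64 * q) W * ∑ i ∈ I with l < 2 * (T W i).card, w i ≤
      1 / 8 * (1 / 4) ^ l := by
  have hp0 : 0 < 64 * q := by linarith
  have hchoice : ∀ Z : Finset X, ∃ S : Finset X, S.card ≤ l ∧
      ((∃ j ∈ I, A j ⊆ Z) → ∃ j ∈ I, A j ⊆ Z ∧ S = A j) := by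
    intro Z
    by_cases h : ∃ j ∈ I, A j ⊆ Z
    · obtain ⟨j, hj, hjZ⟩ := h
      exact ⟨A j, hl j hj, fun _ => ⟨j, hj, hjZ, rfl⟩⟩
    · exact ⟨∅, by simp, fun h' => absurd h' h⟩
  choose S hSl hS using hchoice
  have hsingle : ∀ i ∈ I, ∑ W : Finset X with l < 2 * (T W i).card, bernoulliWeight (64 * q) W ≤
      ∑ x : Finset X × Finset X with x.2 ⊆ S x.1 ∧ l < 2 * x.2.card ∧ x.2 ⊆ A i,
        bernoulliWeight (64 * q) x.1 * (1 / (64 * q)) ^ x.2.card := by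
    intro i hi
    have hinj : Set.InjOn (fun W => (W ∪ T W i, T W i))
        (Finset.univ.filter fun W : Finset X => l < 2 * (T W i).card : Finset (Finset X)) := by
      intro W _ W' _ h
      simp only [Prod.mk.injEq] at h
      have e1 := Finset.union_sdiff_cancel_right (hT W i hi).2.1
      have e2 := Finset.union_sdiff_cancel_right (hT W' i hi).2.1
      rw [← e1, ← e2, h.1, h.2]
    refine (Finset.sum_le_sum fun W _ =>
      bernoulliWeight_le_union hp0 hq1 (hT W i hi).2.1).trans ?_
    rw [← Finset.sum_image (f := fun x : Finset X × Finset X =>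
      bernoulliWeight (64 * q) x.1 * (1 / (64 * q)) ^ x.2.card) hinj]
    refine Finset.sum_le_sum_of_subset_of_nonneg ?_ fun x _ _ =>
      mul_nonneg (bernoulliWeight_nonneg hp0.le hq1 _) (by positivity)
    intro x hx
    obtain ⟨W, hW, rfl⟩ := Finset.mem_image.1 hx
    obtain ⟨h1, h2, h3, h4⟩ := hT W i hi
    obtain ⟨j, hj, hjZ, hSj⟩ := hS _ h3
    simp only [Finset.mem_filter, Finset.mem_univ, true_and] at hW ⊢
    exact ⟨hSj ▸ h4 j hj hjZ, hW, h1⟩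
  calc ∑ W : Finset X, bernoulliWeight (64 * q) W * ∑ i ∈ I with l < 2 * (T W i).card, w i
      = ∑ i ∈ I, w i *
          ∑ W : Finset X with l < 2 * (T W i).card, bernoulliWeight (64 * q) W := by
        simp only [Finset.sum_filter, Finset.mul_sum]
        rw [Finset.sum_comm]
        refine Finset.sum_congr rfl fun i _ => Finset.sum_congr rfl fun W _ => ?_
        split_ifs <;> ring
    _ ≤ ∑ i ∈ I, w i *
          ∑ x : Finset X × Finset X with x.2 ⊆ S x.1 ∧ l < 2 * x.2.card ∧ x.2 ⊆ A i,
            bernoulliWeight (64 * q) x.1 * (1 / (64 * q)) ^ x.2.card :=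
        Finset.sum_le_sum fun i hi => mul_le_mul_of_nonneg_left (hsingle i hi) (hw i)
    _ = ∑ x : Finset X × Finset X with x.2 ⊆ S x.1 ∧ l < 2 * x.2.card,
          bernoulliWeight (64 * q) x.1 * (1 / (64 * q)) ^ x.2.card *
            ∑ i ∈ I with x.2 ⊆ A i, w i := by
        simp only [Finset.sum_filter, Finset.mul_sum]
        rw [Finset.sum_comm]
        refine Finset.sum_congr rfl fun x _ => ?_
        by_cases h : x.2 ⊆ S x.1 ∧ l < 2 * x.2.card
        · rw [if_pos h]
          refine Finset.sum_congr rfl fun i _ => ?_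
          by_cases h' : x.2 ⊆ A i
          · rw [if_pos ⟨h.1, h.2, h'⟩, if_pos h']
            ring
          · rw [if_neg fun hh => h' hh.2.2, if_neg h']
            ring
        · rw [if_neg h]
          refine Finset.sum_eq_zero fun i _ => ?_
          rw [if_neg fun hh => h ⟨hh.1, hh.2.1⟩, mul_zero]
    _ ≤ ∑ x : Finset X × Finset X with x.2 ⊆ S x.1 ∧ l < 2 * x.2.card,
          bernoulliWeight (64 * q) x.1 * (1 / 8) ^ (l + 1) := by
        refine Finset.sum_le_sum fun x hx => ?_
        rw [mul_assoc]
        refine mul_le_mul_of_nonneg_left ?_ (bernoulliWeight_nonneg hp0.le hq1 _)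
        calc (1 / (64 * q)) ^ x.2.card * ∑ i ∈ I with x.2 ⊆ A i, w i
            ≤ (1 / (64 * q)) ^ x.2.card * q ^ x.2.card :=
              mul_le_mul_of_nonneg_left (hspread _) (by positivity)
          -- `64 = 8 ^ 2` turns the lower bound `l + 1` on twice the fragment size into an exponent.
          _ = (1 / 8) ^ (2 * x.2.card) := by
              rw [← mul_pow, pow_mul]
              congr 1
              field_simp
              norm_num
          _ ≤ (1 / 8) ^ (l + 1) := by
              refine pow_le_pow_of_le_one (by norm_num) (by norm_num) ?_
              exact (Finset.mem_filter.1 hx).2.2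
    _ ≤ ∑ x : Finset X × Finset X with x.2 ⊆ S x.1,
          bernoulliWeight (64 * q) x.1 * (1 / 8) ^ (l + 1) := by
        refine Finset.sum_le_sum_of_subset_of_nonneg ?_ fun x _ _ =>
          mul_nonneg (bernoulliWeight_nonneg hp0.le hq1 _) (by positivity)
        intro x hx
        simp only [Finset.mem_filter, Finset.mem_univ, true_and] at hx ⊢
        exact hx.1
    _ = ∑ Z : Finset X, bernoulliWeight (64 * q) Z * (2 ^ (S Z).card * (1 / 8) ^ (l + 1)) := by
        rw [Finset.sum_filter, ← Finset.univ_product_univ, Finset.sum_product]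
        refine Finset.sum_congr rfl fun Z _ => ?_
        rw [← Finset.sum_filter]
        simp only [Finset.sum_const]
        have : (Finset.univ.filter fun V : Finset X => V ⊆ S Z) = (S Z).powerset := by
          ext; simp
        rw [this, Finset.card_powerset, nsmul_eq_mul]
        push_cast
        ring
    _ ≤ ∑ Z : Finset X, bernoulliWeight (64 * q) Z * (2 ^ l * (1 / 8) ^ (l + 1)) := by
        refine Finset.sum_le_sum fun Z _ =>
          mul_le_mul_of_nonneg_left ?_ (bernoulliWeight_nonneg hp0.le hq1 _)
        exact mul_le_mul_of_nonneg_right (pow_le_pow_right₀ (by norm_num) (hSl Z)) (by positivity)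
    _ = 1 / 8 * (1 / 4) ^ l := by
        rw [← Finset.sum_mul, sum_bernoulliWeight, one_mul, pow_succ, ← mul_assoc, ← mul_pow]
        norm_num
        ring

/-- The density of the union of `k` independent `p`-random sets. -/
theorem one_sub_one_sub_pow_le {p : ℝ} (h1 : p ≤ 1) (k : ℕ) :
    1 - (1 - p) ^ k ≤ k * p := by
  have := one_add_mul_le_pow (a := -p) (by linarith) k
  rw [← sub_eq_add_neg] at this
  linarith

open Classical in
/-- A spread family of sets of size less than `2 ^ k` is likely to have a member in the union of
`k` independent `64 q`-random sets. -/
theorem le_productProb_of_spread {q : ℝ} (hq : 0 < q) (hq1 : 64 * q ≤ 1) {w : ι → ℝ}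
    (hw : ∀ i, 0 ≤ w i) (k : ℕ) :
    ∀ (l : ℕ) (I : Finset ι) (A : ι → Finset X), l < 2 ^ k → (∀ i ∈ I, (A i).card ≤ l) →
      (∀ T : Finset X, ∑ i ∈ I with T ⊆ A i, w i ≤ q ^ T.card) →
      ∑ i ∈ I, w i - 1 / 4 * (1 - (1 / 2) ^ l) ≤
        productProb (1 - (1 - 64 * q) ^ k) (upClosure {S | ∃ i ∈ I, S = A i}) := by
  -- The total weight is left free, since each round discards indices with large fragments; `1 / 4 *
  -- (1 - (1 / 2) ^ l)` is the loss allowed over all remaining rounds.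
  induction k with
  | zero =>
    intro l I A hl hA hspread
    obtain rfl : l = 0 := by simpa using hl
    rcases I.eq_empty_or_nonempty with rfl | ⟨i, hi⟩
    · rw [Finset.sum_empty, productProb_eq_sum_filter]
      simp only [pow_zero, sub_self, mul_zero]
      exact Finset.sum_nonneg fun W _ => bernoulliWeight_nonneg le_rfl zero_le_one W
    · have hAi : A i = ∅ := by simpa using hA i hi
      have : upClosure {S | ∃ i ∈ I, S = A i} = Set.univ :=
        Set.eq_univ_of_forall fun T => ⟨∅, ⟨i, hi, hAi.symm⟩, by simp⟩
      rw [this, productProb_univ]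
      have := hspread ∅
      simpa using this
  | succ k ih =>
    intro l I A hl hA hspread
    have hex : ∀ (W : Finset X) (i : ι), ∃ T : Finset X, i ∈ I → T ⊆ A i ∧ Disjoint W T ∧
        (∃ j ∈ I, A j ⊆ W ∪ T) ∧ ∀ k ∈ I, A k ⊆ W ∪ T → T ⊆ A k := by
      intro W i
      by_cases hi : i ∈ I
      · obtain ⟨T, hT⟩ := exists_minimal_fragment I A W hi
        exact ⟨T, fun _ => hT⟩
      · exact ⟨∅, fun h => absurd h hi⟩
    choose T hT using hex
    have hp0 : 0 ≤ 64 * q := by linarith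
    have hbad := sum_large_fragment_le hw hq hq1 hA hspread hT
    have hpk0 : 0 ≤ 1 - (1 - 64 * q) ^ k :=
      sub_nonneg.2 (pow_le_one₀ (by linarith) (by linarith))
    have hpk1 : 1 - (1 - 64 * q) ^ k ≤ 1 := by
      have : 0 ≤ (1 - 64 * q) ^ k := pow_nonneg (by linarith) _
      linarith
    rw [show 1 - (1 - 64 * q) ^ (k + 1) =
      64 * q + (1 - 64 * q) * (1 - (1 - 64 * q) ^ k) by ring, productProb_add]
    have hstep : ∀ W : Finset X, ∑ i ∈ I, w i - ∑ i ∈ I with l < 2 * (T W i).card, w i -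
        1 / 4 * (1 - (1 / 2) ^ (l / 2)) ≤ productProb (1 - (1 - 64 * q) ^ k)
          {V | W ∪ V ∈ upClosure {S | ∃ i ∈ I, S = A i}} := by
      intro W
      -- The retained fragments inherit spreadness because each lies in its `A i`.
      have h1 := ih (l / 2) (I.filter fun i => ¬ l < 2 * (T W i).card) (T W)
        (by rw [pow_succ] at hl; omega)
        (fun i hi => by have := (Finset.mem_filter.1 hi).2; omega)
        (fun U => by
          refine le_trans (Finset.sum_le_sum_of_subset_of_nonneg ?_ fun i _ _ => hw i) (hspread U)
          intro i hi
          simp only [Finset.mem_filter] at hi ⊢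
          exact ⟨hi.1.1, hi.2.trans (hT W i hi.1.1).1⟩)
      have h2 := Finset.sum_filter_add_sum_filter_not I (fun i => l < 2 * (T W i).card) w
      refine le_trans (by linarith) (h1.trans (productProb_mono hpk0 hpk1 ?_))
      rintro V ⟨S, ⟨i, hi, rfl⟩, hV⟩
      obtain ⟨j, hj, hjW⟩ := (hT W i (Finset.mem_filter.1 hi).1).2.2.1
      exact ⟨A j, ⟨j, hj, rfl⟩, hjW.trans (Finset.union_subset_union_right hV)⟩
    have hsum := Finset.sum_le_sum fun W (_ : W ∈ (Finset.univ : Finset (Finset X))) =>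
      mul_le_mul_of_nonneg_left (hstep W) (bernoulliWeight_nonneg hp0 hq1 W)
    refine le_trans ?_ hsum
    simp only [mul_sub]
    rw [Finset.sum_sub_distrib, Finset.sum_sub_distrib]
    simp only [← mul_sub]
    rw [← Finset.sum_mul, ← Finset.sum_mul, sum_bernoulliWeight]
    -- For `l = 0` no loss is allowed and `hbad` is too weak, but all fragments are empty and
    -- nothing is discarded.
    rcases Nat.eq_zero_or_pos l with rfl | hlpos
    · have : ∑ W : Finset X, bernoulliWeight (64 * q) W *
          ∑ i ∈ I with 0 < 2 * (T W i).card, w i = 0 := by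
        refine Finset.sum_eq_zero fun W _ => ?_
        rw [Finset.filter_false_of_mem, Finset.sum_empty, mul_zero]
        intro i hi
        have := (Finset.card_le_card (hT W i hi).1).trans (hA i hi)
        omega
      rw [this]
      norm_num
    -- The round loses at most `1 / 8 * (1 / 4) ^ l`, while the allowance drops by at least `1 / 4 *
    -- (1 / 2) ^ l`.
    · have e1 : (1 / 2 : ℝ) ^ (l - 1) ≤ (1 / 2) ^ (l / 2) :=
        pow_le_pow_of_le_one (by norm_num) (by norm_num) (by omega)
      have e2 : (1 / 2 : ℝ) ^ l = 1 / 2 * (1 / 2) ^ (l - 1) := by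
        rw [← pow_succ']
        congr 1
        omega
      have e3 : (1 / 4 : ℝ) ^ l ≤ (1 / 2) ^ l := pow_le_pow_left₀ (by norm_num) (by norm_num) l
      have e4 : (0 : ℝ) < (1 / 2) ^ l := by positivity
      linarith

open Classical in
/-- The threshold bound for spread families: at density at least `192 q log l`, a `q`-spread
probability distribution on sets of size at most `l` has a member in the random set with
probability more than one half. -/
theorem half_lt_productProb_of_spread {q : ℝ} (hq : 0 < q) {w : ι → ℝ} (hw : ∀ i, 0 ≤ w i)
    {l : ℕ} (hl : 2 ≤ l) {I : Finset ι} {A : ι → Finset X} (hsum : ∑ i ∈ I, w i = 1)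
    (hA : ∀ i ∈ I, (A i).card ≤ l)
    (hspread : ∀ T : Finset X, ∑ i ∈ I with T ⊆ A i, w i ≤ q ^ T.card)
    (hlt : 192 * q * Real.log l ≤ 1) :
    ∃ p : ℝ, 0 ≤ p ∧ p ≤ 192 * q * Real.log l ∧
      1 / 2 < productProb p (upClosure {S | ∃ i ∈ I, S = A i}) := by
  have hl0 : (0 : ℝ) < l := by positivity
  have hlog2 := Real.log_two_gt_d9
  -- The number of rounds is at most `(2 / log 2) log l`, and `2 / log 2 < 3`; hence `192 = 64 * 3`.
  have hk : ((Nat.log 2 l + 1 : ℕ) : ℝ) ≤ 3 * Real.log l := by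
    have h1 : (Nat.log 2 l : ℝ) * Real.log 2 ≤ Real.log l := by
      rw [← Real.log_pow]
      refine Real.log_le_log (by positivity) ?_
      exact_mod_cast Nat.pow_log_le_self 2 (by omega)
    have h2 : Real.log 2 ≤ Real.log l :=
      Real.log_le_log (by norm_num) (by exact_mod_cast hl)
    push_cast
    nlinarith [Nat.cast_nonneg (α := ℝ) (Nat.log 2 l)]
  have hk' : 64 * q * ((Nat.log 2 l + 1 : ℕ) : ℝ) ≤ 192 * q * Real.log l := by nlinarith
  have hk1 : (1 : ℝ) ≤ ((Nat.log 2 l + 1 : ℕ) : ℝ) := by push_cast; simp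
  have hq1 : 64 * q ≤ 1 := by nlinarith
  refine ⟨1 - (1 - 64 * q) ^ (Nat.log 2 l + 1),
    sub_nonneg.2 (pow_le_one₀ (by linarith) (by linarith)), ?_, ?_⟩
  · have := one_sub_one_sub_pow_le hq1 (Nat.log 2 l + 1)
    linarith
  · have h := le_productProb_of_spread hq hq1 hw (Nat.log 2 l + 1) l I A
      (Nat.lt_pow_succ_log_self (by norm_num) l) hA hspread
    have : (0 : ℝ) < (1 / 2) ^ l := by positivity
    linarith

end Spread

namespace RGraph

/-! ### Cycles and leaves -/

section Forest

variable {r n : ℕ}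

theorem IsForest.mono {F G : RGraph r n} (hG : G.IsForest) (h : F ⊆ G) : F.IsForest := by
  rintro ⟨k, hk, v, e, hv, he, hc⟩
  exact hG ⟨k, hk, v, e, hv, he, fun i => ⟨h (hc i).1, (hc i).2⟩⟩

theorem isForest_empty : (∅ : RGraph r n).IsForest := by
  rintro ⟨k, hk, v, e, -, -, hc⟩
  simpa using (hc 0).1

theorem exists_isForest_card_eq (F : RGraph r n) :
    ∃ G ⊆ F, G.IsForest ∧ G.card = F.forestNumber := by
  classical
  obtain ⟨G, hG, hGc⟩ := Finset.exists_mem_eq_sup (F.powerset.filter fun G => IsForest G)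
    ⟨∅, by simpa using isForest_empty⟩ Finset.card
  rw [Finset.mem_filter, Finset.mem_powerset] at hG
  refine ⟨G, hG.1, hG.2, ?_⟩
  rw [← hGc, forestNumber]

/-- A walk that never turns back at a vertex or at an edge contains a cycle. -/
theorem hasCycle_of_walk {F : RGraph r n} (v : ℕ → Fin n) (e : ℕ → KEdge r n)
    (heF : ∀ i, e i ∈ F) (hv : ∀ i, v i ∈ (e i).1) (hv' : ∀ i, v (i + 1) ∈ (e i).1)
    (hvv : ∀ i, v (i + 1) ≠ v i) (hee : ∀ i, e (i + 1) ≠ e i) : F.HasCycle := by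
  classical
  -- The least `m` for which some `v s` recurs in `e (s + m)` gives a cycle of length `m + 1`; a
  -- repeated vertex or edge would give an earlier return.
  have hex : ∃ m, 1 ≤ m ∧ ∃ s, v s ∈ (e (s + m)).1 := by
    obtain ⟨a, b, hab, h⟩ := Finite.exists_ne_map_eq_of_infinite v
    rcases lt_or_gt_of_ne hab with hlt | hlt
    · exact ⟨b - a, by omega, a, by rw [Nat.add_sub_cancel' hlt.le, h]; exact hv b⟩
    · exact ⟨a - b, by omega, b, by rw [Nat.add_sub_cancel' hlt.le, ← h]; exact hv a⟩
  obtain ⟨hm1, s, hs⟩ := Nat.find_spec hex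
  have hmin : ∀ a b, a < b → b < a + Nat.find hex → v a ∉ (e b).1 := by
    intro a b hab hb hmem
    refine Nat.find_min hex (m := b - a) (by omega) ⟨by omega, a, ?_⟩
    rwa [Nat.add_sub_cancel' hab.le]
  obtain ⟨m, hm⟩ : ∃ m, m = Nat.find hex := ⟨_, rfl⟩
  rw [← hm] at hm1 hs hmin
  have hvne : ∀ i j, i < j → j ≤ i + m → v i ≠ v j := by
    intro i j hij hj h
    rcases Nat.lt_or_ge (i + 1) j with hlt | hge
    · refine hmin i (j - 1) (by omega) (by omega) ?_
      have := hv' (j - 1)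
      rwa [Nat.sub_add_cancel (by omega), ← h] at this
    · obtain rfl : j = i + 1 := by omega
      exact hvv i h.symm
  have hene : ∀ i j, i < j → j ≤ i + m → e i ≠ e j := by
    intro i j hij hj h
    rcases Nat.lt_or_ge (i + 1) j with hlt | hge
    · exact hmin (i + 1) j hlt (by omega) (h ▸ hv' i)
    · obtain rfl : j = i + 1 := by omega
      exact hee i h.symm
  have hinj : ∀ {α : Type} (f : ℕ → α), (∀ i j, i < j → j ≤ i + m → f i ≠ f j) →
      Function.Injective fun i : ZMod (m + 1) => f (s + i.val) := by
    intro α f hf i j hij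
    have hi := ZMod.val_lt i
    have hj := ZMod.val_lt j
    refine ZMod.val_injective _ ?_
    rcases lt_trichotomy i.val j.val with h | h | h
    · exact absurd hij (hf _ _ (by omega) (by omega))
    · exact h
    · exact absurd hij.symm (hf _ _ (by omega) (by omega))
  -- Vertices are shifted by one against edges to match `v (i - 1), v i ∈ e i`; the last vertex
  -- wraps round to `v s`.
  refine ⟨m + 1, by omega, fun i => v (s + (i + 1).val), fun i => e (s + i.val),
    (hinj v hvne).comp (add_left_injective 1), hinj e hene, fun i => ⟨heF _, ?_, ?_⟩⟩
  · simpa using hv (s + i.val)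
  · have hi := ZMod.val_lt i
    have h1 : (i + 1).val = (i.val + 1) % (m + 1) := by
      rw [ZMod.val_add, ZMod.val_one'' (by omega)]
    simp only [h1]
    rcases Nat.lt_or_ge (i.val + 1) (m + 1) with hlt | hge
    · rw [Nat.mod_eq_of_lt hlt, ← add_assoc]
      exact hv' _
    · have : i.val = m := by omega
      rw [this, Nat.mod_self]
      exact hs

/-- A nonempty forest has an edge that meets the other edges in at most one vertex. -/
theorem IsForest.exists_leaf {F : RGraph r n} (hF : F.IsForest) (hr : 0 < r) (hne : F.Nonempty) :
    ∃ e ∈ F, ∃ u ∈ e.1, ∀ w ∈ e.1, w ≠ u → ∀ e' ∈ F, e' ≠ e → w ∉ e'.1 := by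
  by_contra! hcon
  obtain ⟨e₀, he₀⟩ := hne
  obtain ⟨u₀, hu₀⟩ := Finset.card_pos.1 (e₀.2.symm ▸ hr)
  -- A state is an edge with its entry vertex. Without a leaf, every edge can be left through
  -- another vertex into another edge, forever.
  let P := {x : KEdge r n × Fin n // x.1 ∈ F ∧ x.2 ∈ x.1.1}
  have hstep : ∀ x : P, ∃ y : P, y.1.2 ∈ x.1.1.1 ∧ y.1.2 ≠ x.1.2 ∧ y.1.1 ≠ x.1.1 := by
    rintro ⟨⟨e, u⟩, he, hu⟩
    obtain ⟨w, hw, hwu, e', he', hee', hwe'⟩ := hcon e he u hu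
    exact ⟨⟨(e', w), he', hwe'⟩, hw, hwu, hee'⟩
  choose step h1 h2 h3 using hstep
  let seq : ℕ → P := fun i => step^[i] ⟨(e₀, u₀), he₀, hu₀⟩
  have hseq : ∀ i, seq (i + 1) = step (seq i) := fun i => Function.iterate_succ_apply' _ _ _
  refine hF (hasCycle_of_walk (fun i => (seq i).1.2) (fun i => (seq i).1.1)
    (fun i => (seq i).2.1) (fun i => (seq i).2.2) (fun i => ?_) (fun i => ?_) fun i => ?_)
  · simpa only [hseq] using h1 (seq i)
  · simpa only [hseq] using h2 (seq i)
  · simpa only [hseq] using h3 (seq i)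

end Forest

/-! ### Counting embeddings of forests and subgraphs -/

section Count

variable {r n : ℕ}

/-- The maps of the vertex set that send every edge of `F` to an edge of `H`. -/
def homs (F H : RGraph r n) : Finset (Fin n → Fin n) :=
  Finset.univ.filter fun f => ∀ e ∈ F, ∃ h ∈ H, e.1.image f = h.1

/-- The permutations of the vertex set that send every edge of `F` to an edge of `H`. -/
def permHoms (F H : RGraph r n) : Finset (Equiv.Perm (Fin n)) :=
  Finset.univ.filter fun σ => ∀ e ∈ F, permEdge σ e ∈ H

theorem mem_homs {F H : RGraph r n} {f : Fin n → Fin n} :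
    f ∈ homs F H ↔ ∀ e ∈ F, ∃ h ∈ H, e.1.image f = h.1 := by
  simp [homs]

theorem mem_permHoms {F H : RGraph r n} {σ : Equiv.Perm (Fin n)} :
    σ ∈ permHoms F H ↔ ∀ e ∈ F, permEdge σ e ∈ H := by
  simp [permHoms]

theorem degree_le_maxDegree (H : RGraph r n) (v : Fin n) : H.degree v ≤ H.maxDegree :=
  Finset.le_sup (f := fun v => H.degree v) (Finset.mem_univ v)

theorem card_piFinset_ite {α β : Type*} [Fintype α] [DecidableEq α] (A : Finset α)
    (s : Finset β) (f : α → β) :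
    (Fintype.piFinset fun a => if a ∈ A then s else {f a}).card = s.card ^ A.card := by
  rw [Fintype.card_piFinset]
  have : ∀ a, (if a ∈ A then s else {f a}).card = if a ∈ A then s.card else 1 := by
    intro a
    split_ifs <;> simp
  simp [this]

/-- Double counting of pairs agreeing off the `r - 1` free vertices of `e`. On these `g` is
arbitrary, as no edge of `F` meets them; conversely, given `g u`, there are at most `Δ(H)` image
edges and `r ^ (r - 1)` ways to fill one. Counting all maps, not only injective ones, is what makes
the choices independent. -/
theorem card_homs_insert_mul_le {F H : RGraph r n} {e : KEdge r n} {u : Fin n} (hu : u ∈ e.1)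
    (hdisj : ∀ w ∈ e.1, w ≠ u → ∀ e' ∈ F, w ∉ e'.1) :
    (homs (insert e F) H).card * n ^ (r - 1) ≤
      (homs F H).card * (H.maxDegree * r ^ (r - 1)) := by
  classical
  have hA : (e.1.erase u).card = r - 1 := by rw [Finset.card_erase_of_mem hu, e.2]
  refine Finset.card_mul_le_card_mul
    (fun f g : Fin n → Fin n => ∀ a ∉ e.1.erase u, f a = g a) (fun f hf => ?_) fun g hg => ?_
  · have hc := card_piFinset_ite (e.1.erase u) (Finset.univ : Finset (Fin n)) f
    rw [hA, Finset.card_univ, Fintype.card_fin] at hc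
    rw [← hc]
    refine Finset.card_le_card fun g hg => ?_
    rw [Fintype.mem_piFinset] at hg
    have hfg : ∀ a ∉ e.1.erase u, f a = g a := by
      intro a ha
      have := hg a
      rw [if_neg ha, Finset.mem_singleton] at this
      exact this.symm
    refine Finset.mem_filter.2 ⟨mem_homs.2 fun e' he' => ?_, hfg⟩
    obtain ⟨h, hh, hfe⟩ := mem_homs.1 hf e' (Finset.mem_insert_of_mem he')
    refine ⟨h, hh, hfe ▸ Finset.image_congr fun a ha => (hfg a fun haA => ?_).symm⟩
    exact hdisj a (Finset.mem_of_mem_erase haA) (Finset.ne_of_mem_erase haA) e' he' ha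
  · have hsub : (homs (insert e F) H).bipartiteBelow
        (fun f g : Fin n → Fin n => ∀ a ∉ e.1.erase u, f a = g a) g ⊆
        (H.filter fun h => g u ∈ h.1).biUnion fun h =>
          Fintype.piFinset fun a => if a ∈ e.1.erase u then h.1 else {g a} := by
      intro f hf
      obtain ⟨hf, hfg⟩ := Finset.mem_filter.1 hf
      obtain ⟨h, hh, hfe⟩ := mem_homs.1 hf e (Finset.mem_insert_self _ _)
      have hmem : ∀ a ∈ e.1, f a ∈ h.1 := fun a ha => hfe ▸ Finset.mem_image_of_mem f ha
      refine Finset.mem_biUnion.2 ⟨h, Finset.mem_filter.2 ⟨hh, ?_⟩, Fintype.mem_piFinset.2 ?_⟩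
      · rw [← hfg u (by simp)]
        exact hmem u hu
      · intro a
        split_ifs with ha
        · exact hmem a (Finset.mem_of_mem_erase ha)
        · exact Finset.mem_singleton.2 (hfg a ha)
    refine (Finset.card_le_card hsub).trans ((Finset.card_biUnion_le_card_mul _ _ (r ^ (r - 1))
      fun h _ => ?_).trans (Nat.mul_le_mul_right _ (H.degree_le_maxDegree (g u))))
    rw [card_piFinset_ite, hA, h.2]

theorem IsForest.card_homs_mul_le (hr : 0 < r) (H : RGraph r n) (m : ℕ) :
    ∀ F : RGraph r n, F.IsForest → F.card = m →
      (homs F H).card * (n ^ (r - 1)) ^ m ≤ (H.maxDegree * r ^ (r - 1)) ^ m * n ^ n := by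
  classical
  induction m with
  | zero =>
    intro F _ _
    simpa using Finset.card_le_univ (homs F H)
  | succ m ih =>
    intro F hF hm
    obtain ⟨e, he, u, hu, hleaf⟩ := hF.exists_leaf hr (Finset.card_pos.1 (by omega))
    have h1 := card_homs_insert_mul_le (F := F.erase e) (H := H) hu fun w hw hwu e' he' =>
      hleaf w hw hwu e' (Finset.mem_of_mem_erase he') (Finset.ne_of_mem_erase he')
    rw [Finset.insert_erase he] at h1
    have h2 := ih (F.erase e) (hF.mono (Finset.erase_subset _ _))
      (by rw [Finset.card_erase_of_mem he, hm]; rfl)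
    calc (homs F H).card * (n ^ (r - 1)) ^ (m + 1)
        = (homs F H).card * n ^ (r - 1) * (n ^ (r - 1)) ^ m := by ring
      _ ≤ (homs (F.erase e) H).card * (H.maxDegree * r ^ (r - 1)) * (n ^ (r - 1)) ^ m :=
          Nat.mul_le_mul_right _ h1
      _ = (H.maxDegree * r ^ (r - 1)) * ((homs (F.erase e) H).card * (n ^ (r - 1)) ^ m) := by
          ring
      _ ≤ (H.maxDegree * r ^ (r - 1)) * ((H.maxDegree * r ^ (r - 1)) ^ m * n ^ n) :=
          Nat.mul_le_mul_left _ h2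
      _ = _ := by ring

theorem card_perm_eqOn_le (V : Finset (Fin n)) (g : Fin n → Fin n) :
    (Finset.univ.filter fun σ : Equiv.Perm (Fin n) => ∀ a ∈ V, σ a = g a).card ≤
      (n - V.card).factorial := by
  classical
  rcases (Finset.univ.filter fun σ : Equiv.Perm (Fin n) =>
    ∀ a ∈ V, σ a = g a).eq_empty_or_nonempty with h | ⟨σ₀, hσ₀⟩
  · simp [h]
  · have hσ₀' := (Finset.mem_filter.1 hσ₀).2
    have hcard : (Finset.univ.filter fun σ : Equiv.Perm (Fin n) =>
        ∀ a, ¬ a ∉ V → σ a = a).card = (n - V.card).factorial := by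
      rw [← Fintype.card_subtype,
        ← Fintype.card_congr (Equiv.Perm.subtypeEquivSubtypePerm fun a => a ∉ V),
        Fintype.card_perm, Fintype.card_subtype_compl]
      simp
    rw [← hcard]
    -- Translation by `σ₀⁻¹` turns extensions of `g` into permutations fixing `V` pointwise.
    refine Finset.card_le_card_of_injOn (fun σ => σ₀⁻¹ * σ) (fun σ hσ => ?_)
      fun σ _ τ _ h => mul_left_cancel h
    have hσ' := (Finset.mem_filter.1 hσ).2
    refine Finset.mem_filter.2 ⟨Finset.mem_univ _, fun a ha => ?_⟩
    rw [not_not] at ha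
    simp [hσ' a ha, ← hσ₀' a ha]

/-- Double counting of pairs agreeing on the vertices covered by `F`: elsewhere a map is free, and a
permutation has at most `(n - |V|)!` completions. -/
theorem card_permHoms_mul_le (F H : RGraph r n) :
    (permHoms F H).card * n ^ (n - (F.biUnion fun e => e.1).card) ≤
      (homs F H).card * (n - (F.biUnion fun e => e.1).card).factorial := by
  classical
  set V := F.biUnion fun e => e.1 with hV
  refine Finset.card_mul_le_card_mul
    (fun (σ : Equiv.Perm (Fin n)) (g : Fin n → Fin n) => ∀ a ∈ V, σ a = g a)
    (fun σ hσ => ?_) fun g hg => ?_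
  · have hc := card_piFinset_ite Vᶜ (Finset.univ : Finset (Fin n)) σ
    rw [Finset.card_compl, Finset.card_univ, Fintype.card_fin] at hc
    rw [← hc]
    refine Finset.card_le_card fun g hg => ?_
    rw [Fintype.mem_piFinset] at hg
    have hfg : ∀ a ∈ V, σ a = g a := by
      intro a ha
      have := hg a
      rw [if_neg (by simpa using ha), Finset.mem_singleton] at this
      exact this.symm
    refine Finset.mem_filter.2 ⟨mem_homs.2 fun e he => ?_, hfg⟩
    refine ⟨_, mem_permHoms.1 hσ e he, ?_⟩
    refine Eq.trans ?_ (Finset.map_eq_image _ _).symm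
    exact Finset.image_congr fun a ha => (hfg a (Finset.mem_biUnion.2 ⟨e, he, ha⟩)).symm
  · refine (Finset.card_le_card ?_).trans (card_perm_eqOn_le V g)
    intro σ hσ
    exact Finset.mem_filter.2 ⟨Finset.mem_univ _, (Finset.mem_filter.1 hσ).2⟩

/-- With `(n)_v` the falling factorial, `n ^ v / (n)_v ≤ v ^ v / v! ≤ e ^ v`: the first factor by
factor from `n (v - i) ≤ v (n - i)`, the second from one term of the exponential series. -/
theorem pow_mul_factorial_sub_le {v n : ℕ} (h : v ≤ n) :
    (n : ℝ) ^ v * (n - v).factorial ≤ Real.exp 1 ^ v * n.factorial := by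
  have h1 : n ^ v * v.factorial ≤ v ^ v * n.descFactorial v := by
    rw [← Nat.descFactorial_self v, Nat.descFactorial_eq_prod_range,
      Nat.descFactorial_eq_prod_range]
    have hconst : ∀ a : ℕ, a ^ v = ∏ _i ∈ Finset.range v, a := fun a => by simp
    rw [hconst n, hconst v, ← Finset.prod_mul_distrib, ← Finset.prod_mul_distrib]
    refine Finset.prod_le_prod' fun i hi => ?_
    have hi := Finset.mem_range.1 hi
    rw [Nat.mul_sub, Nat.mul_sub, mul_comm v n]
    exact Nat.sub_le_sub_left (Nat.mul_le_mul_right i h) _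
  have h2 : (v : ℝ) ^ v ≤ Real.exp 1 ^ v * v.factorial := by
    have := Real.pow_div_factorial_le_exp (x := (v : ℝ)) (Nat.cast_nonneg v) v
    rw [div_le_iff₀ (by positivity)] at this
    rwa [← Real.exp_nat_mul, mul_one]
  have h3 := Nat.factorial_mul_descFactorial h
  have hv : (0 : ℝ) < v.factorial := by positivity
  refine le_of_mul_le_mul_right ?_ hv
  calc (n : ℝ) ^ v * (n - v).factorial * v.factorial
      = ((n ^ v * v.factorial : ℕ) : ℝ) * (n - v).factorial := by push_cast; ring
    _ ≤ ((v ^ v * n.descFactorial v : ℕ) : ℝ) * (n - v).factorial := by gcongr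
    _ = (v : ℝ) ^ v * (((n - v).factorial * n.descFactorial v : ℕ) : ℝ) := by push_cast; ring
    _ ≤ (Real.exp 1 ^ v * v.factorial) * n.factorial := by
        rw [h3]
        gcongr
    _ = _ := by ring

/-- The probability that a random permutation sends a forest `F` into `H`. -/
theorem IsForest.card_permHoms_mul_le (hr : 0 < r) (hn : 0 < n) {F : RGraph r n}
    (hF : F.IsForest) (H : RGraph r n) :
    ((permHoms F H).card : ℝ) * ((n : ℝ) ^ (r - 1)) ^ F.card ≤
      (H.maxDegree * (r : ℝ) ^ (r - 1) * Real.exp 1 ^ r) ^ F.card * n.factorial := by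
  set v := (F.biUnion fun e => e.1).card with hv
  have hvn : v ≤ n := by simpa using Finset.card_le_univ (F.biUnion fun e => e.1)
  have hvr : v ≤ r * F.card := by
    rw [mul_comm]
    exact Finset.card_biUnion_le_card_mul _ _ _ fun e _ => e.2.le
  have h1 : ((permHoms F H).card : ℝ) * (n : ℝ) ^ (n - v) ≤
      (homs F H).card * (n - v).factorial := by
    exact_mod_cast RGraph.card_permHoms_mul_le F H
  have h2 : ((homs F H).card : ℝ) * ((n : ℝ) ^ (r - 1)) ^ F.card ≤
      (H.maxDegree * (r : ℝ) ^ (r - 1)) ^ F.card * (n : ℝ) ^ n := by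
    exact_mod_cast hF.card_homs_mul_le hr H F.card F rfl
  have h3 := pow_mul_factorial_sub_le hvn
  have h4 : Real.exp 1 ^ v ≤ Real.exp 1 ^ (r * F.card) :=
    pow_le_pow_right₀ (Real.one_le_exp zero_le_one) hvr
  have hpos : (0 : ℝ) < (n : ℝ) ^ (n - v) := by positivity
  refine le_of_mul_le_mul_right ?_ hpos
  calc ((permHoms F H).card : ℝ) * ((n : ℝ) ^ (r - 1)) ^ F.card * (n : ℝ) ^ (n - v)
      = ((permHoms F H).card : ℝ) * (n : ℝ) ^ (n - v) * ((n : ℝ) ^ (r - 1)) ^ F.card := by ring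
    _ ≤ (homs F H).card * (n - v).factorial * ((n : ℝ) ^ (r - 1)) ^ F.card := by gcongr
    _ = (homs F H).card * ((n : ℝ) ^ (r - 1)) ^ F.card * (n - v).factorial := by ring
    _ ≤ (H.maxDegree * (r : ℝ) ^ (r - 1)) ^ F.card * (n : ℝ) ^ n * (n - v).factorial := by gcongr
    _ = (H.maxDegree * (r : ℝ) ^ (r - 1)) ^ F.card *
          ((n : ℝ) ^ v * (n - v).factorial) * (n : ℝ) ^ (n - v) := by
        have : (n : ℝ) ^ n = (n : ℝ) ^ v * (n : ℝ) ^ (n - v) := by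
          rw [← pow_add, Nat.add_sub_cancel' hvn]
        rw [this]
        ring
    _ ≤ (H.maxDegree * (r : ℝ) ^ (r - 1)) ^ F.card *
          (Real.exp 1 ^ (r * F.card) * n.factorial) * (n : ℝ) ^ (n - v) := by
        refine mul_le_mul_of_nonneg_right (mul_le_mul_of_nonneg_left ?_ ?_) hpos.le
        · exact h3.trans (by gcongr)
        · positivity
    _ = _ := by
        rw [pow_mul]
        simp only [mul_pow]
        ring

theorem permEdge_mul (σ τ : Equiv.Perm (Fin n)) (e : KEdge r n) :
    permEdge (σ * τ) e = permEdge σ (permEdge τ e) := by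
  apply Subtype.ext
  simp [permEdge, Finset.map_map]
  rfl

theorem permEdge_one (e : KEdge r n) : permEdge 1 e = e := by
  apply Subtype.ext
  ext a
  simp only [permEdge, Finset.mem_map_equiv]
  rfl

theorem permEdge_injective (σ : Equiv.Perm (Fin n)) :
    Function.Injective (permEdge (r := r) σ) := by
  intro e e' h
  have := congrArg (permEdge σ⁻¹) h
  rwa [← permEdge_mul, ← permEdge_mul, inv_mul_cancel, permEdge_one, permEdge_one] at this

theorem subset_image_permEdge_inv_iff {T H : RGraph r n} {σ : Equiv.Perm (Fin n)} :
    T ⊆ H.image (permEdge σ⁻¹) ↔ σ ∈ permHoms T H := by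
  rw [mem_permHoms]
  refine forall₂_congr fun e _ => ?_
  rw [Finset.mem_image]
  constructor
  · rintro ⟨h, hh, rfl⟩
    rwa [← permEdge_mul, mul_inv_cancel, permEdge_one]
  · intro h
    exact ⟨_, h, by rw [← permEdge_mul, inv_mul_cancel, permEdge_one]⟩

theorem permHoms_mono {F G H : RGraph r n} (h : F ⊆ G) : permHoms G H ⊆ permHoms F H := by
  intro σ hσ
  exact mem_permHoms.2 fun e he => mem_permHoms.1 hσ e (h he)

theorem card_permHoms_le_image (T H : RGraph r n) (τ : Equiv.Perm (Fin n)) :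
    (permHoms T H).card ≤ (permHoms (T.image (permEdge τ)) H).card := by
  refine Finset.card_le_card_of_injOn (fun σ => σ * τ⁻¹) (fun σ hσ => mem_permHoms.2 ?_)
    fun σ _ σ' _ h => mul_right_cancel h
  intro e he
  obtain ⟨e', he', rfl⟩ := Finset.mem_image.1 he
  rw [← permEdge_mul, inv_mul_cancel_right]
  exact mem_permHoms.1 hσ e' he'

theorem card_permHoms_div_le_of_subset {c : ℝ} {H : RGraph r n} (hr : 0 < r) (hn : 2 ≤ n)
    (hH : 1 ≤ H.maxDegree) (hc : H.forestDeficiency ≤ c / Real.log n) {S : RGraph r n}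
    (hS : S ⊆ H) (hne : S.Nonempty) :
    ((permHoms S H).card : ℝ) / n.factorial ≤
      (H.maxDegree * ((r : ℝ) ^ (r - 1) * Real.exp 1 ^ r * Real.exp ((r - 1 : ℕ) * c)) /
        (n : ℝ) ^ (r - 1)) ^ S.card := by
  obtain ⟨F, hFS, hF, hFc⟩ := S.exists_isForest_card_eq
  have hlog : 0 < Real.log n := Real.log_pos (by exact_mod_cast hn)
  have hn0 : (0 : ℝ) < n := by positivity
  have hS0 : (0 : ℝ) < S.card := by exact_mod_cast Finset.card_pos.2 hne
  have hFScard := Finset.card_le_card hFS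
  have hdef : ((S.card - F.card : ℕ) : ℝ) * Real.log n ≤ c * S.card := by
    have h1 : 1 - (S.forestNumber : ℝ) / S.card ≤ c / Real.log n :=
      ((isGreatest_forestDeficiency (hne.mono hS)).2 ⟨S, hS, hne, rfl⟩).trans hc
    rw [← hFc, one_sub_div hS0.ne', div_le_div_iff₀ hS0 hlog] at h1
    rwa [Nat.cast_sub hFScard]
  set x : ℝ := (n : ℝ) ^ (r - 1) with hx
  set b : ℝ := H.maxDegree * (r : ℝ) ^ (r - 1) * Real.exp 1 ^ r with hb
  have hx0 : 0 < x := by positivity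
  have hb1 : 1 ≤ b := by
    have e1 : (1 : ℝ) ≤ H.maxDegree := by exact_mod_cast hH
    have e2 : (1 : ℝ) ≤ (r : ℝ) ^ (r - 1) := one_le_pow₀ (by exact_mod_cast hr)
    have e3 : (1 : ℝ) ≤ Real.exp 1 ^ r := one_le_pow₀ (Real.one_le_exp zero_le_one)
    exact one_le_mul_of_one_le_of_one_le (one_le_mul_of_one_le_of_one_le e1 e2) e3
  -- The hypothesis on `φ(H)` enters here: `n` raised to the number of missing edges is at most `exp
  -- (c |S|)`.
  have hxpow : x ^ (S.card - F.card) ≤ Real.exp ((r - 1 : ℕ) * c) ^ S.card := by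
    rw [hx, ← Real.exp_log hn0, ← Real.exp_nat_mul, ← Real.exp_nat_mul, ← Real.exp_nat_mul]
    refine Real.exp_le_exp.2 ?_
    have := mul_le_mul_of_nonneg_left hdef (Nat.cast_nonneg (α := ℝ) (r - 1))
    linarith
  have hcount := hF.card_permHoms_mul_le hr (by omega) H
  have hfac : (0 : ℝ) < n.factorial := by positivity
  calc ((permHoms S H).card : ℝ) / n.factorial
      ≤ ((permHoms F H).card : ℝ) / n.factorial := by
        gcongr
        exact permHoms_mono hFS
    _ ≤ (b / x) ^ F.card := by
        rw [div_pow, div_le_div_iff₀ hfac (by positivity)]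
        exact hcount
    _ ≤ (b / x) ^ F.card * b ^ (S.card - F.card) :=
        le_mul_of_one_le_right (by positivity) (one_le_pow₀ hb1)
    _ = (b / x) ^ S.card * x ^ (S.card - F.card) := by
        nth_rewrite 2 [← Nat.add_sub_cancel' hFScard]
        rw [pow_add, mul_assoc, ← mul_pow, div_mul_cancel₀ _ hx0.ne']
    _ ≤ (b / x) ^ S.card * Real.exp ((r - 1 : ℕ) * c) ^ S.card := by gcongr
    _ = _ := by
        rw [← mul_pow, hb]
        congr 1
        ring

/-- The copies of `H` under a random permutation are spread. -/
theorem card_permHoms_div_le {c : ℝ} {H : RGraph r n} (hr : 0 < r) (hn : 2 ≤ n)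
    (hH : 1 ≤ H.maxDegree) (hc : H.forestDeficiency ≤ c / Real.log n) (T : RGraph r n) :
    ((permHoms T H).card : ℝ) / n.factorial ≤
      (H.maxDegree * ((r : ℝ) ^ (r - 1) * Real.exp 1 ^ r * Real.exp ((r - 1 : ℕ) * c)) /
        (n : ℝ) ^ (r - 1)) ^ T.card := by
  rcases (permHoms T H).eq_empty_or_nonempty with h | ⟨τ, hτ⟩
  · rw [h, Finset.card_empty, Nat.cast_zero, zero_div]
    positivity
  · rcases T.eq_empty_or_nonempty with rfl | hT
    · rw [Finset.card_empty, pow_zero, div_le_one (by positivity)]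
      have := Finset.card_le_univ (permHoms ∅ H)
      rw [Fintype.card_perm, Fintype.card_fin] at this
      exact_mod_cast this
    -- The deficiency bound concerns subsets of `H` only, so `T` is replaced by its image under `τ`,
    -- which loses no permutations.
    · have hsub : T.image (permEdge τ) ⊆ H := by
        intro e he
        obtain ⟨e', he', rfl⟩ := Finset.mem_image.1 he
        exact mem_permHoms.1 hτ e' he'
      have h1 := card_permHoms_div_le_of_subset hr hn hH hc hsub (hT.image _)
      rw [Finset.card_image_of_injective _ (permEdge_injective τ)] at h1
      refine le_trans ?_ h1
      exact div_le_div_of_nonneg_right (by exact_mod_cast card_permHoms_le_image T H τ)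
        (by positivity)

end Count

end RGraph

/-! ### The threshold for copies of `H` -/

open RGraph in
theorem theorem7p1 (r : ℕ) (c : ℝ) :
    ∃ K : ℝ, ∀ (n : ℕ) (d : ℝ) (H : RGraph r n),
      2 ≤ H.card →
      (H.maxDegree : ℝ) ≤ d →
      H.forestDeficiency ≤ c / Real.log (n : ℝ) →
      ∃ pc : ℝ, IsThreshold (containsCopy H) pc ∧
        pc < K * d * (n : ℝ) ^ (-((r : ℤ) - 1)) * Real.log (H.card : ℝ) := by
  classical
  set C : ℝ := (r : ℝ) ^ (r - 1) * Real.exp 1 ^ r * Real.exp ((r - 1 : ℕ) * c) with hC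
  refine ⟨192 * C, fun n d H hH hd hc => ?_⟩
  obtain ⟨e, he, e', he', hee'⟩ := Finset.one_lt_card.1 (show 1 < H.card by omega)
  -- With `r = 0` or `n ≤ 1` there is at most one possible edge, against `2 ≤ H.card`.
  have hr : 0 < r := by
    by_contra hr
    obtain rfl : r = 0 := by omega
    exact hee' (Subtype.ext ((Finset.card_eq_zero.1 e.2).trans (Finset.card_eq_zero.1 e'.2).symm))
  have hn : 2 ≤ n := by
    by_contra hn
    have hle : Fintype.card (Fin n) ≤ 1 := by simp; omega
    have := Fintype.card_le_one_iff_subsingleton.1 hle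
    have huniv : ∀ a : KEdge r n, a.1 = Finset.univ := by
      intro a
      obtain ⟨x, hx⟩ := Finset.card_pos.1 (a.2.symm ▸ hr)
      exact Finset.eq_univ_of_forall fun y => Subsingleton.elim x y ▸ hx
    exact hee' (Subtype.ext ((huniv e).trans (huniv e').symm))
  have hdeg : 1 ≤ H.maxDegree := by
    obtain ⟨x, hx⟩ := Finset.card_pos.1 (e.2.symm ▸ hr)
    exact (Finset.card_pos.2 ⟨e, Finset.mem_filter.2 ⟨he, hx⟩⟩).trans_le
      (H.degree_le_maxDegree x)
  have hmono : ∀ S ∈ containsCopy H, ∀ T, S ⊆ T → T ∈ containsCopy H := by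
    rintro S ⟨R, hR, hRS⟩ T hST
    exact ⟨R, hR, hRS.trans hST⟩
  have hempty : ∅ ∉ containsCopy H := by
    rintro ⟨R, ⟨σ, rfl⟩, hR⟩
    exact Finset.notMem_empty _ (hR (Finset.mem_image_of_mem _ he))
  have huniv : Finset.univ ∈ containsCopy H := ⟨_, ⟨1, rfl⟩, Finset.subset_univ _⟩
  obtain ⟨pc, hpc⟩ := exists_isThreshold hmono hempty huniv
  refine ⟨pc, hpc, ?_⟩
  have hn0 : (0 : ℝ) < n := by positivity
  have hC0 : 0 < C := by positivity
  have hlog : 0 < Real.log H.card := Real.log_pos (by exact_mod_cast hH)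
  have hD : (0 : ℝ) < H.maxDegree := by exact_mod_cast hdeg
  set q : ℝ := H.maxDegree * C / (n : ℝ) ^ (r - 1) with hq
  have hq0 : 0 < q := by positivity
  have hbound : 192 * q * Real.log H.card ≤
      192 * C * d * (n : ℝ) ^ (-((r : ℤ) - 1)) * Real.log H.card := by
    have : (n : ℝ) ^ (-((r : ℤ) - 1)) = ((n : ℝ) ^ (r - 1))⁻¹ := by
      rw [zpow_neg, show (r : ℤ) - 1 = ((r - 1 : ℕ) : ℤ) by omega, zpow_natCast]
    rw [this, hq, div_eq_mul_inv]
    refine mul_le_mul_of_nonneg_right ?_ hlog.le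
    rw [← mul_assoc]
    refine mul_le_mul_of_nonneg_right ?_ (by positivity)
    nlinarith
  refine lt_of_lt_of_le ?_ hbound
  -- A bound above 1 is trivial, since `pc ≤ 1`.
  rcases lt_or_ge 1 (192 * q * Real.log H.card) with hbig | hsmall
  · exact hpc.1.1.2.trans_lt hbig
  · obtain ⟨p, hp0, hp, hhalf⟩ := half_lt_productProb_of_spread hq0
      (w := fun _ : Equiv.Perm (Fin n) => ((n.factorial : ℝ))⁻¹) (fun _ => by positivity) hH
      -- With the inverse, `T ⊆ A σ` says exactly that `σ` sends `T` into `H`.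
      (I := Finset.univ) (A := fun σ => H.image (permEdge σ⁻¹))
      (by
        rw [Finset.sum_const, Finset.card_univ, Fintype.card_perm, Fintype.card_fin,
          nsmul_eq_mul, mul_inv_cancel₀ (by positivity)])
      (fun σ _ => Finset.card_image_le)
      (fun T => by
        have h := card_permHoms_div_le hr hn hdeg hc T
        refine le_trans (le_of_eq ?_) h
        rw [Finset.sum_const, nsmul_eq_mul, div_eq_mul_inv]
        congr 3
        ext σ
        simp only [Finset.mem_filter, Finset.mem_univ, true_and]
        exact subset_image_permEdge_inv_iff)
      hsmall
    have hsub : upClosure {S | ∃ σ ∈ (Finset.univ : Finset (Equiv.Perm (Fin n))),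
        S = H.image (permEdge σ⁻¹)} ⊆ containsCopy H := by
      rintro T ⟨S, ⟨σ, -, rfl⟩, hT⟩
      exact ⟨_, ⟨σ⁻¹, rfl⟩, hT⟩
    have hlt := hhalf.trans_le (productProb_mono hp0 (hp.trans hsmall) hsub)
    refine lt_of_lt_of_le ?_ hp
    by_contra! hle
    rcases hle.eq_or_lt with rfl | hlt'
    · exact hlt.ne' hpc.1.2
    · have := productProb_strictMono hmono hempty huniv hp0 hlt' hpc.1.1.2
      rw [hpc.1.2] at this
      linarith
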